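/- Let $\mathbb{K}\in\{\mathbb{R},\mathbb{C}\}$, $1\le p<\infty$, $N\ge 2$ and $\beta>1$, and write $\ell^p=\ell^p(\mathbb{N})$ over $\mathbb{K}$ with $\mathbb{N}=\{1,2,\dots\}$. A unilateral pseudo-shift on $\ell^p$ is an operator $$T_{f,\omega}\Big(\sum_{m\ge1}\alpha_m e_m\Big)=\sum_{m\ge1} w_{f(m)}\,\alpha_{f(m)}\,e_m,$$ where $f:\mathbb{N}\to\mathbb{N}$ is strictly increasing with $f(1)>1$ and $\omega=(w_{f(m)})_{m\in\mathbb{N}}$ is a bounded sequence of nonzero scalars. Then there exist unilateral pseudo-shifts $T_1,\dots,T_N$ on $X=\ell^p$ (not necessarily distinct) with $\|T_1\|=\cdots=\|T_N\|=\beta$ such that the following three assertions hold. 1. $T_1,\dots,T_N$ satisfy the Simultaneous Blow-up/Collapse Criterion: there are a strictly increasing sequence $(n_k)$ of positive integers, a dense set $X_0\subset X$ and maps $S_k:X_0\to X$ such that $T_i^{n_k}x\to0$ as $k\to\infty$ for all $x\in X_0$ and $1\le i\le N$, and such that for all $\varepsilon>0$, $K\in\mathbb{N}$ and $x_0\in X_0$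 there is $k\ge K$ with $\|S_k(x_0)\|<\varepsilon$ and $\|T_i^{n_k}S_k(x_0)-x_0\|<\varepsilon$ for all $1\le i\le N$. 2. $T_1,\dots,T_N$ are s-hypercyclic: there is $x\in X$ such that the closure of $\{(T_1^nx,\dots,T_N^nx):n\in\mathbb{N}\}$ in $X^N$ contains the diagonal $\Delta=\{(y,\dots,y):y\in X\}$. 3. $T_1,\dots,T_N$ do not satisfy the s-Hypercyclicity Criterion, i.e. there do not exist a strictly increasing sequence $(n_k)$ of positive integers, a dense set $X_0\subset X$, a set $W_0\subset X^N$ with $\overline{W_0}\supset\Delta$ and maps $R_k:W_0\to X$ such that (a) $T_i^{n_k}x\to0$ as $k\to\infty$ for all $x\in X_0$ and $1\le i\le N$; (b) $R_kw\to0$ as $k\to\infty$ for all $w\in W_0$; and (c) for every $w=(w_1,\dots,w_N)\in W_0$ and $1\le i\le N$ there is $y_i\in\operatorname{conv}\{w_1,\dots,w_N\}$ with $T_i^{n_k}R_kw\to y_i$ as $k\to\infty$. -/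

import Mathlib

open Filter Topology
open scoped ENNReal

noncomputable section

/-- The data of a unilateral pseudo-shift: a strictly increasing `f : ℕ → ℕ` moving the first index
to the right, and weights `w (f m)` that are nonzero and bounded. The coordinates of `ℓ^p` are
indexed by `0, 1, 2, …`, so that the first index is `0`. Only the values of `w` on the range of
`f` matter. -/
structure PseudoShift (𝕜 : Type*) [RCLike 𝕜] where
  f : ℕ → ℕ
  w : ℕ → 𝕜
  strictMono : StrictMono f
  first_lt : 0 < f 0
  weight_ne_zero : ∀ m, w (f m) ≠ 0
  weight_bounded : ∃ C : ℝ, ∀ m, ‖w (f m)‖ ≤ C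

/-- The Banach space `ℓ^p(ℕ)` over `𝕜`. -/
abbrev EllP (𝕜 : Type*) [RCLike 𝕜] (p : ℝ≥0∞) : Type _ := lp (fun _ : ℕ => 𝕜) p

namespace PseudoShift

variable {𝕜 : Type*} [RCLike 𝕜]

theorem sum_bound (P : PseudoShift 𝕜) {p : ℝ≥0∞} (hp : 0 < p.toReal) {C : ℝ} (hC0 : 0 ≤ C)
    (hC : ∀ m, ‖P.w (P.f m)‖ ≤ C) (x : EllP 𝕜 p) (s : Finset ℕ) :
    ∑ m ∈ s, ‖P.w (P.f m) * x (P.f m)‖ ^ p.toReal ≤ (C * ‖x‖) ^ p.toReal := by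
  calc ∑ m ∈ s, ‖P.w (P.f m) * x (P.f m)‖ ^ p.toReal
      ≤ ∑ m ∈ s, C ^ p.toReal * ‖x (P.f m)‖ ^ p.toReal := by
        refine Finset.sum_le_sum fun m _ => ?_
        rw [norm_mul, Real.mul_rpow (norm_nonneg _) (norm_nonneg _)]
        gcongr
        exact hC m
    _ = C ^ p.toReal * ∑ j ∈ s.map ⟨P.f, P.strictMono.injective⟩, ‖x j‖ ^ p.toReal := by
        rw [Finset.mul_sum, Finset.sum_map]
        exact Finset.sum_congr rfl fun m _ => rfl
    _ ≤ C ^ p.toReal * ‖x‖ ^ p.toReal := by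
        gcongr
        exact lp.sum_rpow_le_norm_rpow hp x _
    _ = (C * ‖x‖) ^ p.toReal := (Real.mul_rpow hC0 (lp.norm_nonneg' _)).symm

theorem exists_bound (P : PseudoShift 𝕜) : ∃ C : ℝ, 0 ≤ C ∧ ∀ m, ‖P.w (P.f m)‖ ≤ C := by
  obtain ⟨C, hC⟩ := P.weight_bounded
  exact ⟨C, (norm_nonneg _).trans (hC 0), hC⟩

theorem memlp (P : PseudoShift 𝕜) (p : ℝ≥0∞) [hp : Fact (1 ≤ p)] (x : EllP 𝕜 p) :
    Memℓp (fun m => P.w (P.f m) * x (P.f m)) p := by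
  obtain ⟨C, hC0, hC⟩ := P.exists_bound
  rcases eq_or_ne p ⊤ with rfl | htop
  · refine memℓp_infty ⟨C * ‖x‖, ?_⟩
    rintro _ ⟨m, rfl⟩
    simp only [norm_mul]
    exact mul_le_mul (hC m) (lp.norm_apply_le_norm (by simp) x _) (norm_nonneg _) hC0
  · have h0 : 0 < p.toReal := ENNReal.toReal_pos (zero_lt_one.trans_le hp.out).ne' htop
    exact memℓp_gen' (P.sum_bound h0 hC0 hC x)

/-- The pseudo-shift `T_{f,w}`, sending `∑ α_m e_m` to `∑ w_{f(m)} α_{f(m)} e_m`, as a bounded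
linear operator on `ℓ^p`. -/
def toCLM (P : PseudoShift 𝕜) (p : ℝ≥0∞) [Fact (1 ≤ p)] : EllP 𝕜 p →L[𝕜] EllP 𝕜 p :=
  LinearMap.mkContinuousOfExistsBound
    { toFun := fun x => ⟨fun m => P.w (P.f m) * x (P.f m), P.memlp p x⟩
      map_add' := fun x y => by
        ext m
        exact mul_add _ _ _
      map_smul' := fun c x => by
        ext m
        simp [mul_left_comm] }
    (by
      obtain ⟨C, hC0, hC⟩ := P.exists_bound
      refine ⟨C, fun x => ?_⟩
      rcases eq_or_ne p ⊤ with rfl | htop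
      · refine lp.norm_le_of_forall_le (by positivity) fun m => ?_
        simp only [LinearMap.coe_mk, AddHom.coe_mk, norm_mul]
        exact mul_le_mul (hC m) (lp.norm_apply_le_norm (by simp) x _) (norm_nonneg _) hC0
      · have h0 : 0 < p.toReal :=
          ENNReal.toReal_pos (zero_lt_one.trans_le (Fact.out : 1 ≤ p)).ne' htop
        exact lp.norm_le_of_forall_sum_le h0 (by positivity) (P.sum_bound h0 hC0 hC x))

@[simp]
theorem toCLM_apply (P : PseudoShift 𝕜) (p : ℝ≥0∞) [Fact (1 ≤ p)] (x : EllP 𝕜 p) (m : ℕ) :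
    P.toCLM p x m = P.w (P.f m) * x (P.f m) := rfl

end PseudoShift

/-- The diagonal of `X^N`. -/
def diagonalSet (X : Type*) (N : ℕ) : Set (Fin N → X) :=
  Set.range fun (x : X) (_ : Fin N) => x

section Dynamics

variable {𝕜 : Type*} [RCLike 𝕜] {X : Type*} [NormedAddCommGroup X] [NormedSpace 𝕜 X] {N : ℕ}

/-- `T₁, …, T_N` are s-hypercyclic: for some `x`, the closure of
`{(T₁^n x, …, T_N^n x) : n = 1, 2, …}` contains the diagonal of `X^N`. -/
def SHypercyclic (T : Fin N → X →L[𝕜] X) : Prop :=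
  ∃ x : X, diagonalSet X N ⊆ closure {v | ∃ n : ℕ, 1 ≤ n ∧ v = fun i => (T i ^ n) x}

/-- The Simultaneous Blow-up/Collapse Criterion. -/
def SBlowUpCollapseCriterion (T : Fin N → X →L[𝕜] X) : Prop :=
  ∃ (n : ℕ → ℕ) (X₀ : Set X) (S : ℕ → X₀ → X),
    StrictMono n ∧ (∀ k, 0 < n k) ∧ Dense X₀ ∧
    (∀ x ∈ X₀, ∀ i, Tendsto (fun k => (T i ^ n k) x) atTop (𝓝 0)) ∧
    (∀ ε : ℝ, 0 < ε → ∀ (K : ℕ) (x : X₀), ∃ k, K ≤ k ∧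
      ‖S k x‖ < ε ∧ ∀ i, ‖(T i ^ n k) (S k x) - x‖ < ε)

/-- The s-Hypercyclicity Criterion (with respect to some sequence `(n_k)`). -/
def SHypercyclicityCriterion [NormedSpace ℝ X] (T : Fin N → X →L[𝕜] X) : Prop :=
  ∃ (n : ℕ → ℕ) (X₀ : Set X) (W₀ : Set (Fin N → X)) (R : ℕ → W₀ → X),
    StrictMono n ∧ (∀ k, 0 < n k) ∧ Dense X₀ ∧ diagonalSet X N ⊆ closure W₀ ∧
    (∀ x ∈ X₀, ∀ i, Tendsto (fun k => (T i ^ n k) x) atTop (𝓝 0)) ∧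
    (∀ w : W₀, Tendsto (fun k => R k w) atTop (𝓝 0)) ∧
    (∀ (w : W₀) (i : Fin N), ∃ y ∈ convexHull ℝ (Set.range (w : Fin N → X)),
      Tendsto (fun k => (T i ^ n k) (R k w)) atTop (𝓝 y))

end Dynamics

end

/-!
One operator is `T₀` and all the others are `T₁`, for a pair `T₀`, `T₁` of pseudo-shifts with the
following properties.

*Index maps.* The index maps `f₀`, `f₁` are the two instances of `forkMap`. Both move
`4 ^ j` to `4 ^ (j + 1)` for `j ≥ 1`; moreover `f₀ 0 = f₁ 1 = 4`, so that
`f₀^n 0 = f₁^n 1 = 4 ^ n` for all `n ≥ 1`. Points off these two orbits are sent by `f₀` and `f₁`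
to the residue classes of `1` and `2` modulo `4`, so the only collisions between `f₀^n` and `f₁^n`
are `f₀^n 0 = f₁^n 1` and `f₀^n (4 ^ j) = f₁^n (4 ^ j)` with `j ≥ 1`. The weights are quotients
`g (f m) / g m` of a potential, whence `(T^n x) m = g (f^n m) / g m * x (f^n m)`. On the orbit
`0, 4, 4 ^ 2, …` the potential of `T₀` is `U n`, and on the orbit `1, 4, 4 ^ 2, …` that of `T₁` is
`r n * U n`. Therefore `(T₁^n x) 1 = r n * (T₀^n x) 0` (`forkShift_pow_apply_one`).

*Failure of the s-Hypercyclicity Criterion.* The criterion uses a single sequence `(n_k)` for all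
targets, so the ratios `r (n k)` would have to converge both to a number near `1` and to a number
near `2`, on account of the targets `e₀ + e₁` and `e₀ + 2 e₁`
(`not_sHypercyclicityCriterion_of_ratio`).

*The Blow-up/Collapse Criterion.* Here `n` may depend on the target `x`. Given a finitely supported
`x`, there is a common preimage of `x` under `T₀^n` and `T₁^n` as soon as `r n = x 1 / x 0`, for the
collision at `4 ^ n`, and `r (n + j) = r j` for small `j ≥ 1`, for the collisions at
`4 ^ (n + j)` (`forkShift_one_pow_commonPreimage`). Both conditions are met with
`r n = ρ (v₂ n)`, where `v₂` is the `2`-adic valuation: at `n = 2 ^ k` one has `r n = ρ k` and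
`r (2 ^ k + j) = r j` for `1 ≤ j < 2 ^ k`. It remains to let `ρ` take every value in a dense set
infinitely often. For the preimages to tend to `0`, both potentials must tend to infinity, while the
norms must not exceed `β`; this is possible if `ρ v` lies between `b ^ (-v)` and `b ^ v` with
`b ^ 4 = β`, because `v₂ (n!) ≤ n` bounds the total loss (`dyadicCost_le`).

The criterion implies s-hypercyclicity by a Baire category argument
(`SBlowUpCollapseCriterion.sHypercyclic`).
-/

noncomputable section

/-! ### From the Blow-up/Collapse Criterion to s-hypercyclicity -/

/-- Baire category argument: the set of `x` whose joint orbit visits a given neighbourhood of a given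
diagonal point is open, and it is dense because `y + S_k x` is close to `y` while
`T_i^{n_k} (y + S_k x)` is close to `x`. -/
theorem SBlowUpCollapseCriterion.sHypercyclic {𝕜 : Type*} [RCLike 𝕜] {X : Type*}
    [NormedAddCommGroup X] [NormedSpace 𝕜 X] [CompleteSpace X] [TopologicalSpace.SeparableSpace X]
    {N : ℕ} {T : Fin N → X →L[𝕜] X} (hT : SBlowUpCollapseCriterion T) : SHypercyclic T := by
  obtain ⟨n, X₀, S, -, hpos, hdense, hzero, happ⟩ := hT
  let d : ℕ → X := TopologicalSpace.denseSeq X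
  let O : ℕ × ℕ → Set X := fun q =>
    ⋃ k, ⋂ i, {x | ‖(T i ^ n k) x - d q.1‖ < 1 / ((q.2 : ℝ) + 1)}
  have hopen : ∀ q, IsOpen (O q) := fun q => isOpen_iUnion fun k => isOpen_iInter_of_finite fun i =>
    isOpen_lt (((T i ^ n k).continuous.sub continuous_const).norm) continuous_const
  have hO : ∀ q, Dense (O q) := by
    intro q
    rw [Metric.dense_iff]
    intro z r hr
    set δ : ℝ := 1 / ((q.2 : ℝ) + 1) with hδ
    have hδ0 : 0 < δ := by positivity
    obtain ⟨y, hyX, hy⟩ := hdense.exists_dist_lt z (half_pos hr)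
    obtain ⟨x, hxX, hx⟩ := hdense.exists_dist_lt (d q.1) (by positivity : 0 < δ / 3)
    have hev : ∀ᶠ k in atTop, ∀ i, ‖(T i ^ n k) y‖ < δ / 3 := by
      rw [eventually_all]
      intro i
      have := (hzero y hyX i).norm
      rw [norm_zero] at this
      exact this.eventually_lt_const (by positivity)
    obtain ⟨K, hK⟩ := eventually_atTop.1 hev
    obtain ⟨k, hkK, hSk, hTk⟩ := happ (min (r / 2) (δ / 3)) (by positivity) K ⟨x, hxX⟩
    refine ⟨y + S k ⟨x, hxX⟩, ?_, ?_⟩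
    · rw [Metric.mem_ball, dist_comm]
      calc dist z (y + S k ⟨x, hxX⟩) ≤ dist z y + dist y (y + S k ⟨x, hxX⟩) := dist_triangle _ _ _
        _ < r / 2 + r / 2 := by
          refine add_lt_add hy ?_
          rw [dist_self_add_right]
          exact hSk.trans_le (min_le_left _ _)
        _ = r := add_halves r
    · refine Set.mem_iUnion.2 ⟨k, Set.mem_iInter.2 fun i => ?_⟩
      have h1 := hK k hkK i
      have h2 := (hTk i).trans_le (min_le_right _ _)
      rw [dist_comm, dist_eq_norm] at hx
      have e : (T i ^ n k) (y + S k ⟨x, hxX⟩) - d q.1 =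
          (T i ^ n k) y + ((T i ^ n k) (S k ⟨x, hxX⟩) - x) + (x - d q.1) := by
        rw [map_add]; abel
      change ‖(T i ^ n k) (y + S k ⟨x, hxX⟩) - d q.1‖ < δ
      rw [e]
      refine (norm_add₃_le).trans_lt ?_
      linarith
  obtain ⟨x, hx⟩ := (dense_iInter_of_isOpen hopen hO).nonempty
  refine ⟨x, ?_⟩
  rintro _ ⟨y, rfl⟩
  rw [Metric.mem_closure_iff]
  intro ε hε
  obtain ⟨i₀, hi₀⟩ := (TopologicalSpace.denseRange_denseSeq X).exists_dist_lt y (half_pos hε)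
  obtain ⟨j, hj⟩ := exists_nat_one_div_lt (half_pos hε)
  obtain ⟨k, hk⟩ := Set.mem_iUnion.1 (Set.mem_iInter.1 hx (i₀, j))
  refine ⟨_, ⟨n k, hpos k, rfl⟩, ?_⟩
  rw [dist_pi_lt_iff hε]
  intro i
  have h := Set.mem_iInter.1 hk i
  calc dist y ((T i ^ n k) x) ≤ dist y (d i₀) + dist (d i₀) ((T i ^ n k) x) := dist_triangle _ _ _
    _ < ε / 2 + ε / 2 := by
      refine add_lt_add hi₀ ?_
      rw [dist_comm, dist_eq_norm]
      exact lt_trans h hj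
    _ = ε := add_halves ε

/-! ### Pseudo-shifts whose weights are quotients of a potential -/

theorem le_iterate_of_strictMono {f : ℕ → ℕ} (hf : StrictMono f) (hf0 : 0 < f 0) (n m : ℕ) :
    n ≤ f^[n] m := by
  have hlt : ∀ l, l < f l := fun l => by
    induction l with
    | zero => exact hf0
    | succ l ih => exact lt_of_le_of_lt ih (hf (Nat.lt_succ_self l))
  induction n with
  | zero => exact Nat.zero_le _
  | succ n ih =>
    rw [Function.iterate_succ_apply']
    exact lt_of_le_of_lt ih (hlt _)

/-- The pseudo-shift along `f` with weights `w (f m) = g (f m) / g m`. It is the conjugate of the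
unweighted pseudo-shift along `f` by the diagonal map with entries `g m`, so that the products of
weights occurring in its powers telescope. -/
def PseudoShift.ofPotential {𝕜 : Type*} [RCLike 𝕜] (f : ℕ → ℕ) (hf : StrictMono f) (hf0 : 0 < f 0)
    (g : ℕ → 𝕜) (hg : ∀ m, g m ≠ 0) (C : ℝ) (hC : ∀ m, ‖g (f m)‖ ≤ C * ‖g m‖) : PseudoShift 𝕜 where
  f := f
  w := Function.extend f (fun m => g (f m) / g m) 0
  strictMono := hf
  first_lt := hf0
  weight_ne_zero m := by
    rw [hf.injective.extend_apply]
    exact div_ne_zero (hg _) (hg _)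
  weight_bounded := ⟨C, fun m => by
    rw [hf.injective.extend_apply, norm_div, div_le_iff₀ (norm_pos_iff.2 (hg m))]
    exact hC m⟩

namespace PseudoShift

variable {𝕜 : Type*} [RCLike 𝕜] {p : ℝ≥0∞} [Fact (1 ≤ p)]
  {f : ℕ → ℕ} {hf : StrictMono f} {hf0 : 0 < f 0} {g : ℕ → 𝕜} {hg : ∀ m, g m ≠ 0}
  {C : ℝ} {hC : ∀ m, ‖g (f m)‖ ≤ C * ‖g m‖}

theorem ofPotential_toCLM_apply (x : EllP 𝕜 p) (m : ℕ) :
    (ofPotential f hf hf0 g hg C hC).toCLM p x m = g (f m) / g m * x (f m) := by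
  rw [toCLM_apply]
  change Function.extend f (fun m => g (f m) / g m) 0 (f m) * x (f m) = _
  rw [hf.injective.extend_apply]

theorem ofPotential_toCLM_pow_apply (n : ℕ) (x : EllP 𝕜 p) (m : ℕ) :
    ((ofPotential f hf hf0 g hg C hC).toCLM p ^ n) x m = g (f^[n] m) / g m * x (f^[n] m) := by
  induction n generalizing m with
  | zero => simp [hg]
  | succ n ih =>
    rw [pow_succ', mul_apply_eq_comp, ofPotential_toCLM_apply, ih,
      Function.iterate_succ_apply]
    have := hg (f m)
    field_simp

theorem norm_ofPotential_toCLM (hp : p ≠ ∞) {m₀ : ℕ} (hm₀ : ‖g (f m₀)‖ = C * ‖g m₀‖) :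
    ‖(ofPotential f hf hf0 g hg C hC).toCLM p‖ = C := by
  have h0 : 0 < p.toReal := ENNReal.toReal_pos (zero_lt_one.trans_le (Fact.out : 1 ≤ p)).ne' hp
  have hgm : 0 < ‖g m₀‖ := norm_pos_iff.2 (hg m₀)
  have hC0 : 0 ≤ C := nonneg_of_mul_nonneg_left (hm₀ ▸ norm_nonneg _) hgm
  refine le_antisymm (ContinuousLinearMap.opNorm_le_bound _ hC0 fun x => ?_) ?_
  · refine lp.norm_le_of_forall_sum_le h0 (mul_nonneg hC0 (norm_nonneg _)) (sum_bound _ h0 hC0 ?_ x)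
    intro m
    change ‖Function.extend f (fun m => g (f m) / g m) 0 (f m)‖ ≤ C
    rw [hf.injective.extend_apply, norm_div, div_le_iff₀ (norm_pos_iff.2 (hg m))]
    exact hC m
  · have h := ContinuousLinearMap.le_opNorm ((ofPotential f hf hf0 g hg C hC).toCLM p)
      (lp.single p (f m₀) 1)
    rw [lp.norm_single (zero_lt_one.trans_le Fact.out), norm_one, mul_one] at h
    refine le_trans (le_of_eq ?_) ((lp.norm_apply_le_norm (zero_lt_one.trans_le Fact.out).ne' _
      m₀).trans h)
    rw [ofPotential_toCLM_apply, lp.single_apply_self, mul_one, norm_div, hm₀]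
    field_simp

theorem tendsto_ofPotential_toCLM_pow (x : EllP 𝕜 p) {M : ℕ} (hx : ∀ m, M ≤ m → x m = 0)
    {n : ℕ → ℕ} (hn : Tendsto n atTop atTop) :
    Tendsto (fun k => ((ofPotential f hf hf0 g hg C hC).toCLM p ^ n k) x) atTop (𝓝 0) := by
  refine tendsto_const_nhds.congr' ?_
  filter_upwards [hn.eventually_ge_atTop M] with k hk
  ext m
  rw [ofPotential_toCLM_pow_apply, hx _ (hk.trans (le_iterate_of_strictMono hf hf0 _ m))]
  simp

end PseudoShift

/-! ### Finitely supported sequences -/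

section FiniteSupport

variable {𝕜 : Type*} [RCLike 𝕜] {p : ℝ≥0∞} [Fact (1 ≤ p)]

theorem dense_finitelySupported (hp : p ≠ ∞) :
    Dense {x : EllP 𝕜 p | ∃ M, ∀ m, M ≤ m → x m = 0} := by
  intro x
  have h := (lp.hasSum_single hp x).tendsto_sum_nat
  refine mem_closure_of_tendsto h (Eventually.of_forall fun M => ⟨M, fun m hm => ?_⟩)
  rw [lp.coeFn_sum, Finset.sum_apply]
  refine Finset.sum_eq_zero fun i hi => lp.single_apply_ne _ _ _ ?_
  have := Finset.mem_range.1 hi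
  omega

theorem separableSpace_ellP (hp : p ≠ ∞) : TopologicalSpace.SeparableSpace (EllP 𝕜 p) := by
  have hs : TopologicalSpace.IsSeparable
      (Submodule.span 𝕜 (Set.range fun i : ℕ => (lp.single p i 1 : EllP 𝕜 p)) : Set (EllP 𝕜 p)) :=
    (Set.countable_range _).isSeparable.span
  rw [← TopologicalSpace.isSeparable_univ_iff]
  refine hs.closure.mono fun x _ => ?_
  refine mem_closure_of_tendsto (lp.hasSum_single hp x) (Eventually.of_forall fun s => ?_)
  refine Submodule.sum_mem _ fun i _ => ?_
  have : (lp.single p i (x i) : EllP 𝕜 p) = x i • lp.single p i 1 := by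
    rw [← lp.single_smul, smul_eq_mul, mul_one]
  rw [this]
  exact Submodule.smul_mem _ _ (Submodule.subset_span ⟨i, rfl⟩)

/-- The first two coordinates of a finitely supported sequence can be adjusted by an arbitrarily
small amount so that their ratio lies in a prescribed dense set. -/
theorem dense_finitelySupported_ratio (hp : p ≠ ∞) {D : Set 𝕜} (hD : Dense D) :
    Dense {x : EllP 𝕜 p | (∃ M, ∀ m, M ≤ m → x m = 0) ∧ ∃ d ∈ D, x 1 = d * x 0} := by
  set A := {x : EllP 𝕜 p | (∃ M, ∀ m, M ≤ m → x m = 0) ∧ ∃ d ∈ D, x 1 = d * x 0}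
  let B := {x : EllP 𝕜 p | (∃ M, ∀ m, M ≤ m → x m = 0) ∧ x 0 ≠ 0}
  have hcont : ∀ i : ℕ, Continuous fun a : 𝕜 => (lp.single p i a : EllP 𝕜 p) := fun i =>
    (lp.isometry_single (E := fun _ : ℕ => 𝕜) i).continuous
  have hsupp : ∀ (x : EllP 𝕜 p) (i : ℕ) (a : 𝕜), (∃ M, ∀ m, M ≤ m → x m = 0) →
      ∃ M, ∀ m, M ≤ m → (x + lp.single p i a : EllP 𝕜 p) m = 0 := by
    rintro x i a ⟨M, hM⟩
    refine ⟨M + i + 1, fun m hm => ?_⟩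
    rw [lp.coeFn_add, Pi.add_apply, hM m (by omega), lp.single_apply_ne _ _ _ (by omega), add_zero]
  have hBA : B ⊆ closure A := by
    rintro y ⟨hy, hy0⟩
    have hc : Continuous fun d : 𝕜 => (y + lp.single p 1 (d * y 0 - y 1) : EllP 𝕜 p) :=
      continuous_const.add ((hcont 1).comp (by fun_prop))
    have := hc.range_subset_closure_image_dense hD ⟨y 1 / y 0, rfl⟩
    simp only [div_mul_cancel₀ _ hy0, sub_self, lp.single_zero, add_zero] at this
    refine closure_mono ?_ this
    rintro _ ⟨d, hd, rfl⟩
    refine ⟨hsupp _ _ _ hy, d, hd, ?_⟩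
    simp
  have hFB : {x : EllP 𝕜 p | ∃ M, ∀ m, M ≤ m → x m = 0} ⊆ closure B := by
    intro y hy
    have hc : Continuous fun a : 𝕜 => (y + lp.single p 0 (a - y 0) : EllP 𝕜 p) :=
      continuous_const.add ((hcont 0).comp (by fun_prop))
    have := hc.range_subset_closure_image_dense (dense_compl_singleton (0 : 𝕜)) ⟨y 0, rfl⟩
    simp only [sub_self, lp.single_zero, add_zero] at this
    refine closure_mono ?_ this
    rintro _ ⟨a, ha, rfl⟩
    refine ⟨hsupp _ _ _ hy, ?_⟩
    simpa using ha
  exact (((dense_finitelySupported hp).mono hFB).of_closure.mono hBA).of_closure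

end FiniteSupport

/-! ### Two index maps whose iterates collide on one orbit only -/

/-- The orbit `s, 4, 4 ^ 2, 4 ^ 3, …`, where `s` will be `0` or `1`. -/
def rootedPow (s j : ℕ) : ℕ := if j = 0 then s else 4 ^ j

/-- For `s = 0` or `1`, the index map that shifts the orbit `rootedPow s` by one step and sends
every other `m` to `4 * m + s + 1`. (If `m` is on the orbit, its position there is `Nat.log 4 m`.) -/
def forkMap (s m : ℕ) : ℕ :=
  if m = rootedPow s (Nat.log 4 m) then 4 ^ (Nat.log 4 m + 1) else 4 * m + s + 1

section Fork

variable {s : ℕ}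

theorem log_rootedPow (hs : s < 2) (j : ℕ) : Nat.log 4 (rootedPow s j) = j := by
  unfold rootedPow
  split_ifs with h
  · rw [h]
    exact Nat.log_of_lt (by omega)
  · exact Nat.log_pow (by norm_num) j

theorem rootedPow_succ (s j : ℕ) : rootedPow s (j + 1) = 4 ^ (j + 1) := if_neg (Nat.succ_ne_zero j)

theorem forkMap_rootedPow (hs : s < 2) (j : ℕ) :
    forkMap s (rootedPow s j) = rootedPow s (j + 1) := by
  unfold forkMap
  rw [log_rootedPow hs, if_pos rfl, rootedPow_succ]

theorem forkMap_of_ne {m : ℕ} (h : m ≠ rootedPow s (Nat.log 4 m)) : forkMap s m = 4 * m + s + 1 :=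
  if_neg h

theorem iterate_forkMap_rootedPow (hs : s < 2) (n j : ℕ) :
    (forkMap s)^[n] (rootedPow s j) = rootedPow s (n + j) := by
  induction n with
  | zero => simp
  | succ n ih =>
    rw [Function.iterate_succ_apply', ih, forkMap_rootedPow hs]
    congr 1
    omega

theorem four_mul_add_ne_rootedPow (hs : s < 2) (m j : ℕ) : 4 * m + s + 1 ≠ rootedPow s j := by
  rcases j with _ | j
  · simp only [rootedPow, if_true]
    omega
  · rw [rootedPow_succ, pow_succ]
    omega

/-- Off the orbit `rootedPow s` the iterates of `forkMap s` stay in the residue class of `s + 1`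
modulo `4`. -/
theorem iterate_forkMap_mod (hs : s < 2) {m : ℕ} (h : m ≠ rootedPow s (Nat.log 4 m)) {n : ℕ}
    (hn : n ≠ 0) : (forkMap s)^[n] m % 4 = s + 1 := by
  obtain ⟨n, rfl⟩ := Nat.exists_eq_succ_of_ne_zero hn
  clear hn
  induction n generalizing m with
  | zero =>
    rw [Function.iterate_one, forkMap_of_ne h]
    omega
  | succ n ih =>
    rw [Function.iterate_succ_apply, forkMap_of_ne h]
    exact ih (four_mul_add_ne_rootedPow hs _ _)

theorem iterate_forkMap_rootedPow_mod (hs : s < 2) (j : ℕ) {n : ℕ} (hn : n ≠ 0) :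
    (forkMap s)^[n] (rootedPow s j) % 4 = 0 := by
  obtain ⟨n, rfl⟩ := Nat.exists_eq_succ_of_ne_zero hn
  rw [iterate_forkMap_rootedPow hs, show n.succ + j = (n + j) + 1 by omega, rootedPow_succ, pow_succ]
  omega

theorem forkMap_zero_pos : 0 < forkMap s 0 := by
  unfold forkMap
  split_ifs <;> positivity

theorem strictMono_forkMap (hs : s < 2) : StrictMono (forkMap s) := by
  have hbd : ∀ m, m ≠ 0 → 4 * m ≤ forkMap s m ∧ forkMap s m ≤ 4 * m + 2 := by
    intro m hm
    by_cases h : m = rootedPow s (Nat.log 4 m)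
    · have hm4 : m = 4 ^ Nat.log 4 m := by
        rcases Nat.eq_zero_or_pos (Nat.log 4 m) with h0 | h0
        · rw [h0] at h ⊢
          simp only [rootedPow, if_true] at h
          rw [pow_zero]
          omega
        · rwa [rootedPow, if_neg h0.ne'] at h
      have : forkMap s m = 4 * m := by
        rw [forkMap, if_pos h, pow_succ, ← hm4, mul_comm]
      omega
    · rw [forkMap_of_ne h]
      omega
  refine strictMono_nat_of_lt_succ fun m => ?_
  have h1 := hbd (m + 1) (Nat.succ_ne_zero m)
  rcases Nat.eq_zero_or_pos m with rfl | hm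
  · interval_cases s <;> simp [forkMap, rootedPow]
  · have h2 := hbd m hm.ne'
    omega

/-! ### The associated potentials -/

/-- The potential for the index map `forkMap s` with value `h j` at the `j`-th point of the orbit
`rootedPow s` and growing by a factor `β` per step elsewhere. -/
def forkPotential {𝕜 : Type*} [RCLike 𝕜] (β : ℝ) (s : ℕ) (h : ℕ → 𝕜) (m : ℕ) : 𝕜 :=
  if m = rootedPow s (Nat.log 4 m) then h (Nat.log 4 m) else ((β ^ Nat.log 4 m : ℝ) : 𝕜)

variable {𝕜 : Type*} [RCLike 𝕜] {β : ℝ} {h : ℕ → 𝕜}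

theorem forkPotential_rootedPow (hs : s < 2) (j : ℕ) :
    forkPotential β s h (rootedPow s j) = h j := by
  unfold forkPotential
  rw [log_rootedPow hs, if_pos rfl]

theorem forkPotential_of_ne {m : ℕ} (hm : m ≠ rootedPow s (Nat.log 4 m)) :
    forkPotential β s h m = ((β ^ Nat.log 4 m : ℝ) : 𝕜) :=
  if_neg hm

theorem norm_forkPotential_of_ne (hβ : 1 < β) {m : ℕ} (hm : m ≠ rootedPow s (Nat.log 4 m)) :
    ‖forkPotential β s h m‖ = β ^ Nat.log 4 m := by
  rw [forkPotential_of_ne hm, RCLike.norm_ofReal, abs_of_pos (by positivity)]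

theorem forkPotential_ne_zero (hβ : 1 < β) (hh : ∀ j, h j ≠ 0) (m : ℕ) :
    forkPotential β s h m ≠ 0 := by
  by_cases hm : m = rootedPow s (Nat.log 4 m)
  · rw [forkPotential, if_pos hm]
    exact hh _
  · rw [← norm_pos_iff, norm_forkPotential_of_ne hβ hm]
    positivity

theorem norm_forkPotential_forkMap_le (hβ : 1 < β) (hs : s < 2)
    (hh : ∀ j, ‖h (j + 1)‖ ≤ β * ‖h j‖) (m : ℕ) :
    ‖forkPotential β s h (forkMap s m)‖ ≤ β * ‖forkPotential β s h m‖ := by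
  by_cases hm : m = rootedPow s (Nat.log 4 m)
  · rw [hm, forkMap_rootedPow hs, forkPotential_rootedPow hs, forkPotential_rootedPow hs]
    exact hh _
  · rw [forkMap_of_ne hm, norm_forkPotential_of_ne hβ (four_mul_add_ne_rootedPow hs _ _),
      norm_forkPotential_of_ne hβ hm, ← pow_succ']
    refine pow_le_pow_right₀ hβ.le (Nat.lt_succ_iff.1 (Nat.log_lt_of_lt_pow (by omega) ?_))
    have := Nat.lt_pow_succ_log_self (b := 4) (by norm_num) m
    rw [Nat.succ_eq_add_one] at this ⊢
    rw [pow_succ 4 (Nat.log 4 m + 1)]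
    omega

/-- The bound `norm_forkPotential_forkMap_le` is attained, at the first point that is neither `0`
nor on the orbit `rootedPow s`. -/
theorem norm_forkPotential_forkMap_eq (hβ : 1 < β) (hs : s < 2) :
    ‖forkPotential β s h (forkMap s (s + 1))‖ = β * ‖forkPotential β s h (s + 1)‖ := by
  have hlog : Nat.log 4 (s + 1) = 0 := Nat.log_of_lt (by omega)
  have hlog' : Nat.log 4 (4 * (s + 1) + s + 1) = 1 :=
    (Nat.log_eq_iff (by norm_num)).2 ⟨by omega, by omega⟩
  have hm : s + 1 ≠ rootedPow s (Nat.log 4 (s + 1)) := by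
    rw [hlog]
    simp [rootedPow]
  rw [forkMap_of_ne hm, norm_forkPotential_of_ne hβ (four_mul_add_ne_rootedPow hs _ _),
    norm_forkPotential_of_ne hβ hm, hlog, hlog', pow_one, pow_zero, mul_one]

theorem tendsto_norm_forkPotential (hβ : 1 < β) {b : ℝ} (hb : 1 < b) (hbβ : b ≤ β)
    (hh : ∀ j, b ^ j ≤ ‖h j‖) : Tendsto (fun m => ‖forkPotential β s h m‖) atTop atTop := by
  have hlog : Tendsto (Nat.log 4) atTop atTop :=
    tendsto_atTop_atTop_of_monotone Nat.log_monotone fun n =>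
      ⟨4 ^ n, (Nat.log_pow (by norm_num) n).ge⟩
  refine tendsto_atTop_mono (fun m => ?_) ((tendsto_pow_atTop_atTop_of_one_lt hb).comp hlog)
  by_cases hm : m = rootedPow s (Nat.log 4 m)
  · rw [forkPotential, if_pos hm]
    exact hh _
  · rw [norm_forkPotential_of_ne hβ hm]
    exact pow_le_pow_left₀ (by positivity) hbβ _

end Fork

/-! ### The ratio of the two weight products along the common orbit -/

theorem padicValNat_two_pow_add {k j : ℕ} (hj : j ≠ 0) (hjk : j < 2 ^ k) :
    padicValNat 2 (2 ^ k + j) = padicValNat 2 j := by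
  obtain ⟨v, q, hq, rfl⟩ := Nat.exists_eq_two_pow_mul_odd hj
  have hvk : v < k := by
    have : 2 ^ v < 2 ^ k := lt_of_le_of_lt (Nat.le_mul_of_pos_right _ hq.pos) hjk
    exact (Nat.pow_lt_pow_iff_right (by norm_num)).1 this
  have hodd : Odd (2 ^ (k - v) + q) :=
    Even.add_odd ((Nat.even_pow.2 ⟨even_two, by omega⟩)) hq
  have e : 2 ^ k + 2 ^ v * q = 2 ^ v * (2 ^ (k - v) + q) := by
    rw [mul_add, ← pow_add]
    congr 2
    omega
  have key : ∀ c, Odd c → padicValNat 2 (2 ^ v * c) = v := fun c hc => by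
    rw [padicValNat.mul (by positivity) hc.pos.ne', padicValNat.prime_pow,
      padicValNat.eq_zero_of_not_dvd hc.not_two_dvd_nat, add_zero]
  rw [e, key _ hodd, key _ hq]

/-- The sum of the `2`-adic valuations of `1, …, n` and of `0, …, n - 1`. -/
def dyadicCost (n : ℕ) : ℕ := ∑ i ∈ Finset.range n, (padicValNat 2 (i + 1) + padicValNat 2 i)

theorem dyadicCost_le (n : ℕ) : dyadicCost n ≤ 2 * n := by
  have h1 : ∀ n, ∑ i ∈ Finset.range n, padicValNat 2 (i + 1) = padicValNat 2 n.factorial := by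
    intro n
    induction n with
    | zero => simp
    | succ n ih =>
      rw [Finset.sum_range_succ, ih, Nat.factorial_succ,
        padicValNat.mul (Nat.succ_ne_zero n) n.factorial_ne_zero, add_comm]
  have h2 : padicValNat 2 n.factorial ≤ n := by
    have := sub_one_mul_padicValNat_factorial (p := 2) n
    omega
  have h3 : ∑ i ∈ Finset.range n, padicValNat 2 i ≤ ∑ i ∈ Finset.range n, padicValNat 2 (i + 1) := by
    have e1 := Finset.sum_range_succ' (fun i => padicValNat 2 i) n
    have e2 := Finset.sum_range_succ (fun i => padicValNat 2 i) n
    simp only [padicValNat_zero_right, add_zero] at e1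
    omega
  rw [dyadicCost, Finset.sum_add_distrib]
  have := h1 n
  omega

/-- The weight product of the first operator along the common orbit. Losing the factor
`b ^ padicValNat 2 n` at both steps adjacent to `n` leaves room for a second weight product that
differs from it at `n` by any factor between `b ^ (-padicValNat 2 n)` and `b ^ padicValNat 2 n`. -/
def dyadicGrowth (b : ℝ) (n : ℕ) : ℝ := b ^ (4 * n) / b ^ dyadicCost n

section Growth

variable {b : ℝ}

theorem dyadicGrowth_pos (hb : 1 < b) (n : ℕ) : 0 < dyadicGrowth b n := by
  unfold dyadicGrowth
  positivity

theorem dyadicGrowth_succ (hb : 1 < b) (n : ℕ) :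
    dyadicGrowth b (n + 1) * b ^ padicValNat 2 (n + 1) * b ^ padicValNat 2 n =
      b ^ 4 * dyadicGrowth b n := by
  have : b ≠ 0 := by positivity
  have e : dyadicCost (n + 1) = dyadicCost n + (padicValNat 2 (n + 1) + padicValNat 2 n) :=
    Finset.sum_range_succ _ _
  unfold dyadicGrowth
  rw [e]
  field_simp
  ring

theorem pow_le_dyadicGrowth (hb : 1 < b) (n : ℕ) : b ^ (2 * n) ≤ dyadicGrowth b n := by
  rw [dyadicGrowth, le_div_iff₀ (by positivity), ← pow_add]
  exact pow_le_pow_right₀ hb.le (by have := dyadicCost_le n; omega)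

theorem dyadicGrowth_succ_le (hb : 1 < b) (n : ℕ) :
    dyadicGrowth b (n + 1) ≤ b ^ 4 * dyadicGrowth b n := by
  rw [← dyadicGrowth_succ hb, mul_assoc]
  exact le_mul_of_one_le_right (dyadicGrowth_pos hb _).le
    (one_le_mul_of_one_le_of_one_le (one_le_pow₀ hb.le) (one_le_pow₀ hb.le))

variable {𝕜 : Type*} [RCLike 𝕜] {ρ : ℕ → 𝕜}

theorem norm_mul_dyadicGrowth_succ_le (hb : 1 < b) (h1 : ∀ v, 1 ≤ b ^ v * ‖ρ v‖)
    (h2 : ∀ v, ‖ρ v‖ ≤ b ^ v) (n : ℕ) :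
    ‖ρ (padicValNat 2 (n + 1)) * (dyadicGrowth b (n + 1) : 𝕜)‖ ≤
      b ^ 4 * ‖ρ (padicValNat 2 n) * (dyadicGrowth b n : 𝕜)‖ := by
  have hU := dyadicGrowth_pos hb (n + 1)
  rw [norm_mul, norm_mul, RCLike.norm_ofReal, RCLike.norm_ofReal, abs_of_pos hU,
    abs_of_pos (dyadicGrowth_pos hb n)]
  calc ‖ρ (padicValNat 2 (n + 1))‖ * dyadicGrowth b (n + 1)
      ≤ b ^ padicValNat 2 (n + 1) * dyadicGrowth b (n + 1) := by
        gcongr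
        exact h2 _
    _ ≤ b ^ padicValNat 2 (n + 1) * dyadicGrowth b (n + 1) *
          (b ^ padicValNat 2 n * ‖ρ (padicValNat 2 n)‖) :=
        le_mul_of_one_le_right (by positivity) (h1 _)
    _ = dyadicGrowth b (n + 1) * b ^ padicValNat 2 (n + 1) * b ^ padicValNat 2 n *
          ‖ρ (padicValNat 2 n)‖ := by ring
    _ = b ^ 4 * (‖ρ (padicValNat 2 n)‖ * dyadicGrowth b n) := by
        rw [dyadicGrowth_succ hb]
        ring

theorem pow_le_norm_mul_dyadicGrowth (hb : 1 < b) (h1 : ∀ v, 1 ≤ b ^ v * ‖ρ v‖) (n : ℕ) :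
    b ^ n ≤ ‖ρ (padicValNat 2 n) * (dyadicGrowth b n : 𝕜)‖ := by
  rw [norm_mul, RCLike.norm_ofReal, abs_of_pos (dyadicGrowth_pos hb n)]
  have hv : padicValNat 2 n ≤ n := (padicValNat_le_nat_log n).trans (Nat.log_le_self 2 n)
  calc b ^ n ≤ b ^ n * (b ^ padicValNat 2 n * ‖ρ (padicValNat 2 n)‖) :=
        le_mul_of_one_le_right (by positivity) (h1 _)
    _ = ‖ρ (padicValNat 2 n)‖ * (b ^ n * b ^ padicValNat 2 n) := by ring
    _ ≤ ‖ρ (padicValNat 2 n)‖ * dyadicGrowth b n := by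
        refine mul_le_mul_of_nonneg_left (le_trans ?_ (pow_le_dyadicGrowth hb n)) (norm_nonneg _)
        rw [← pow_add]
        exact pow_le_pow_right₀ hb.le (by omega)

/-- A sequence that takes every value in a dense set infinitely often, slowly enough that its
`v`-th term lies between `b ^ (-v)` and `b ^ v` in absolute value. -/
theorem exists_slow_recurrent_sequence (𝕜 : Type*) [RCLike 𝕜] (hb : 1 < b) :
    ∃ ρ : ℕ → 𝕜, ρ 0 = 1 ∧ (∀ v, 1 ≤ b ^ v * ‖ρ v‖) ∧ (∀ v, ‖ρ v‖ ≤ b ^ v) ∧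
      Dense {d | ∃ᶠ v in atTop, ρ v = d} := by
  classical
  let e : ℕ → 𝕜 := fun v => TopologicalSpace.denseSeq 𝕜 (Nat.unpair v).1
  -- Values out of range are replaced by `1`; a given nonzero value is eventually in range.
  let ρ : ℕ → 𝕜 := fun v => if v ≠ 0 ∧ 1 ≤ b ^ v * ‖e v‖ ∧ ‖e v‖ ≤ b ^ v then e v else 1
  refine ⟨ρ, by simp [ρ], fun v => ?_, fun v => ?_, ?_⟩
  · by_cases h : v ≠ 0 ∧ 1 ≤ b ^ v * ‖e v‖ ∧ ‖e v‖ ≤ b ^ v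
    · simp only [ρ, if_pos h, h.2.1]
    · simpa only [ρ, if_neg h, norm_one, mul_one] using one_le_pow₀ hb.le
  · by_cases h : v ≠ 0 ∧ 1 ≤ b ^ v * ‖e v‖ ∧ ‖e v‖ ≤ b ^ v
    · simp only [ρ, if_pos h, h.2.2]
    · simpa only [ρ, if_neg h, norm_one] using one_le_pow₀ hb.le
  · refine ((TopologicalSpace.denseRange_denseSeq 𝕜).sdiff_singleton 0).mono ?_
    rintro _ ⟨⟨i, rfl⟩, hi⟩
    have hi0 : 0 < ‖TopologicalSpace.denseSeq 𝕜 i‖ := norm_pos_iff.2 hi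
    have hpow := tendsto_pow_atTop_atTop_of_one_lt hb
    have hev : ∀ᶠ v in atTop, v ≠ 0 ∧ 1 ≤ b ^ v * ‖TopologicalSpace.denseSeq 𝕜 i‖ ∧
        ‖TopologicalSpace.denseSeq 𝕜 i‖ ≤ b ^ v := by
      filter_upwards [eventually_ne_atTop 0, (hpow.atTop_mul_const hi0).eventually_ge_atTop 1,
        hpow.eventually_ge_atTop _] with v h1 h2 h3 using ⟨h1, h2, h3⟩
    have hfr : ∃ᶠ v in atTop, e v = TopologicalSpace.denseSeq 𝕜 i := by
      rw [frequently_atTop]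
      exact fun a => ⟨Nat.pair i a, Nat.right_le_pair i a, by simp [e]⟩
    refine (hfr.and_eventually hev).mono ?_
    rintro v ⟨h1, h2⟩
    rw [← h1] at h2 ⊢
    exact if_pos h2

end Growth

/-! ### Failure of the s-Hypercyclicity Criterion -/

/-- Along a sequence `(n_k)` as in the criterion, `r (n k)` would have to converge to the ratio of
coordinate `1` to coordinate `0` of every target vector at once. The targets `e₀ + e₁` and
`e₀ + 2 e₁` already exclude this. -/
theorem not_sHypercyclicityCriterion_of_ratio {𝕜 : Type*} [RCLike 𝕜] {p : ℝ≥0∞} [Fact (1 ≤ p)]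
    {N : ℕ} {T : Fin N → EllP 𝕜 p →L[𝕜] EllP 𝕜 p} {i j : Fin N} {r : ℕ → 𝕜}
    (h : ∀ n, n ≠ 0 → ∀ x, (T j ^ n) x 1 = r n * (T i ^ n) x 0) :
    ¬ SHypercyclicityCriterion T := by
  rintro ⟨n, X₀, W₀, R, -, hpos, -, hW, -, -, hlim⟩
  have hp0 : 0 < p := zero_lt_one.trans_le Fact.out
  have key : ∀ c : 𝕜, ∃ (a : ℕ → 𝕜) (z z' : 𝕜), ‖1 - z‖ < 1 / 10 ∧ ‖c - z'‖ < 1 / 10 ∧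
      Tendsto a atTop (𝓝 z) ∧ Tendsto (fun k => r (n k) * a k) atTop (𝓝 z') := by
    intro c
    let e : EllP 𝕜 p := lp.single p 0 1 + lp.single p 1 c
    have he0 : e 0 = 1 := by simp [e]
    have he1 : e 1 = c := by simp [e]
    obtain ⟨w, hw, hdist⟩ := Metric.mem_closure_iff.1 (hW ⟨e, rfl⟩) (1 / 10) (by norm_num)
    have hball : convexHull ℝ (Set.range w) ⊆ Metric.ball e (1 / 10) := by
      refine convexHull_min ?_ (convex_ball e _)
      rintro _ ⟨l, rfl⟩
      rw [Metric.mem_ball, dist_comm]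
      exact (dist_le_pi_dist _ _ l).trans_lt hdist
    have hcoord : ∀ y ∈ convexHull ℝ (Set.range w), ∀ m, ‖e m - y m‖ < 1 / 10 := by
      intro y hy m
      have h1 := hball hy
      rw [Metric.mem_ball, dist_comm, dist_eq_norm] at h1
      exact (lp.norm_apply_le_norm hp0.ne' (e - y) m).trans_lt h1
    have hev : ∀ m, Continuous fun x : EllP 𝕜 p => x m := fun m =>
      (continuous_apply m).comp lp.uniformContinuous_coe.continuous
    obtain ⟨y, hy, hty⟩ := hlim ⟨w, hw⟩ i
    obtain ⟨y', hy', hty'⟩ := hlim ⟨w, hw⟩ j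
    refine ⟨fun k => (T i ^ n k) (R k ⟨w, hw⟩) 0, y 0, y' 1, ?_, ?_,
      ((hev 0).tendsto y).comp hty, ?_⟩
    · simpa only [he0] using hcoord y hy 0
    · simpa only [he1] using hcoord y' hy' 1
    · refine (((hev 1).tendsto y').comp hty').congr fun k => ?_
      exact h _ (hpos k).ne' _
  obtain ⟨a, z, z', hz, hz', ha, ha'⟩ := key 1
  obtain ⟨c, t, t', ht, ht', hc, hc'⟩ := key 2
  have heq : z' * t = z * t' :=
    tendsto_nhds_unique (ha'.mul hc) ((ha.mul hc').congr fun k => by ring)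
  have h1 : ‖z'‖ ≤ 11 / 10 := by
    have := norm_sub_le (1 : 𝕜) (1 - z')
    rw [sub_sub_cancel, norm_one] at this
    linarith
  have h2 : ‖t‖ ≤ 11 / 10 := by
    have := norm_sub_le (1 : 𝕜) (1 - t)
    rw [sub_sub_cancel, norm_one] at this
    linarith
  have h3 : 9 / 10 ≤ ‖z‖ := by
    have := norm_sub_norm_le (1 : 𝕜) z
    rw [norm_one] at this
    linarith
  have h4 : 19 / 10 ≤ ‖t'‖ := by
    have := norm_sub_norm_le (2 : 𝕜) t'
    rw [RCLike.norm_ofNat] at this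
    linarith
  have h5 : ‖z'‖ * ‖t‖ = ‖z‖ * ‖t'‖ := by rw [← norm_mul, ← norm_mul, heq]
  nlinarith [mul_le_mul h1 h2 (norm_nonneg _) (by norm_num),
    mul_le_mul h3 h4 (by norm_num) (norm_nonneg _)]

/-! ### Preimages under powers of pseudo-shifts -/

/-- The vector with entry `g m / g (f^n m) * x m` at `f^n m`, for `m ∈ A`. It is sent to the
restriction of `x` to `A` by the `n`-th power of the pseudo-shift along `f` with potential `g`. -/
def backwardSum {𝕜 : Type*} [RCLike 𝕜] (p : ℝ≥0∞) (f : ℕ → ℕ) (g : ℕ → 𝕜) (A : Finset ℕ) (n : ℕ)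
    (x : ℕ → 𝕜) : EllP 𝕜 p :=
  ∑ m ∈ A, lp.single p (f^[n] m) (g m / g (f^[n] m) * x m)

section BackwardSum

variable {𝕜 : Type*} [RCLike 𝕜] {p : ℝ≥0∞} {f : ℕ → ℕ} {g : ℕ → 𝕜} {A : Finset ℕ} {x : ℕ → 𝕜}

theorem backwardSum_apply_eq_zero {n l : ℕ} (h : ∀ m ∈ A, f^[n] m ≠ l) :
    backwardSum p f g A n x l = 0 := by
  rw [backwardSum, lp.coeFn_sum, Finset.sum_apply]
  exact Finset.sum_eq_zero fun m hm => lp.single_apply_ne _ _ _ (h m hm).symm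

theorem backwardSum_apply_iterate (hf : f.Injective) {n l : ℕ} (h : l ∈ A ∨ x l = 0) :
    backwardSum p f g A n x (f^[n] l) = g l / g (f^[n] l) * x l := by
  by_cases hl : l ∈ A
  · rw [backwardSum, lp.coeFn_sum, Finset.sum_apply, Finset.sum_eq_single_of_mem l hl,
      lp.single_apply_self]
    exact fun m _ hml => lp.single_apply_ne _ _ _ fun h => hml ((hf.iterate n h).symm)
  · rw [h.resolve_left hl, mul_zero]
    refine backwardSum_apply_eq_zero fun m hm hml => hl ?_
    rwa [← hf.iterate n hml]

theorem tendsto_backwardSum [Fact (1 ≤ p)] (hf : StrictMono f) (hf0 : 0 < f 0)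
    (hg : Tendsto (fun m => ‖g m‖) atTop atTop) :
    Tendsto (fun n => backwardSum p f g A n x) atTop (𝓝 0) := by
  rw [← Finset.sum_const_zero (s := A)]
  refine tendsto_finsetSum _ fun m _ => ?_
  rw [tendsto_zero_iff_norm_tendsto_zero]
  have hm : Tendsto (fun n => f^[n] m) atTop atTop :=
    tendsto_atTop_mono (fun n => le_iterate_of_strictMono hf hf0 n m) tendsto_id
  have := ((hg.comp hm).const_div_atTop ‖g m‖).mul_const ‖x m‖
  rw [zero_mul] at this
  refine this.congr fun n => ?_
  rw [lp.norm_single (zero_lt_one.trans_le Fact.out), norm_mul, norm_div]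
  rfl

end BackwardSum

/-! ### The two pseudo-shifts -/

/-- The pseudo-shift along `forkMap s` with potential `forkPotential β s h`. -/
def forkShift {𝕜 : Type*} [RCLike 𝕜] {β : ℝ} (hβ : 1 < β) {s : ℕ} (hs : s < 2) {h : ℕ → 𝕜}
    (hh0 : ∀ j, h j ≠ 0) (hh : ∀ j, ‖h (j + 1)‖ ≤ β * ‖h j‖) : PseudoShift 𝕜 :=
  PseudoShift.ofPotential (forkMap s) (strictMono_forkMap hs) forkMap_zero_pos
    (forkPotential β s h) (forkPotential_ne_zero hβ hh0) β (norm_forkPotential_forkMap_le hβ hs hh)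

section ForkShift

variable {𝕜 : Type*} [RCLike 𝕜] {p : ℝ≥0∞} [Fact (1 ≤ p)] {β : ℝ} {hβ : 1 < β} {s : ℕ}
  {hs : s < 2} {h : ℕ → 𝕜} {hh0 : ∀ j, h j ≠ 0} {hh : ∀ j, ‖h (j + 1)‖ ≤ β * ‖h j‖}

theorem forkShift_pow_apply (n : ℕ) (x : EllP 𝕜 p) (m : ℕ) :
    ((forkShift hβ hs hh0 hh).toCLM p ^ n) x m =
      forkPotential β s h ((forkMap s)^[n] m) / forkPotential β s h m * x ((forkMap s)^[n] m) :=
  PseudoShift.ofPotential_toCLM_pow_apply n x m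

theorem forkShift_pow_apply_rootedPow (n : ℕ) (x : EllP 𝕜 p) (j : ℕ) :
    ((forkShift hβ hs hh0 hh).toCLM p ^ n) x (rootedPow s j) =
      h (n + j) / h j * x (rootedPow s (n + j)) := by
  rw [forkShift_pow_apply, iterate_forkMap_rootedPow hs, forkPotential_rootedPow hs,
    forkPotential_rootedPow hs]

theorem norm_forkShift_toCLM (hp : p ≠ ∞) : ‖(forkShift hβ hs hh0 hh).toCLM p‖ = β :=
  PseudoShift.norm_ofPotential_toCLM hp (norm_forkPotential_forkMap_eq hβ hs)

theorem tendsto_forkShift_pow (x : EllP 𝕜 p) {M : ℕ} (hx : ∀ m, M ≤ m → x m = 0)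
    {n : ℕ → ℕ} (hn : Tendsto n atTop atTop) :
    Tendsto (fun k => ((forkShift hβ hs hh0 hh).toCLM p ^ n k) x) atTop (𝓝 0) :=
  PseudoShift.tendsto_ofPotential_toCLM_pow x hx hn

end ForkShift

section Pair

variable {𝕜 : Type*} [RCLike 𝕜] {p : ℝ≥0∞} [Fact (1 ≤ p)] {β : ℝ} {hβ : 1 < β}
  {h h' : ℕ → 𝕜} {hh0 : ∀ j, h j ≠ 0} {hh : ∀ j, ‖h (j + 1)‖ ≤ β * ‖h j‖}
  {hh0' : ∀ j, h' j ≠ 0} {hh' : ∀ j, ‖h' (j + 1)‖ ≤ β * ‖h' j‖}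

/-- The collision: both sides are multiples of the coordinate `4 ^ n` of `x`. -/
theorem forkShift_pow_apply_one (h00 : h' 0 = h 0) {n : ℕ} (hn : n ≠ 0) (x : EllP 𝕜 p) :
    ((forkShift hβ one_lt_two hh0' hh').toCLM p ^ n) x 1 =
      h' n / h n * ((forkShift hβ zero_lt_two hh0 hh).toCLM p ^ n) x 0 := by
  have e0 := forkShift_pow_apply_rootedPow (hβ := hβ) (hs := zero_lt_two) (hh0 := hh0) (hh := hh)
    n x 0
  have e1 := forkShift_pow_apply_rootedPow (hβ := hβ) (hs := one_lt_two) (hh0 := hh0') (hh := hh')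
    n x 0
  simp only [rootedPow, if_true, add_zero, if_neg hn] at e0 e1
  rw [e0, e1, h00]
  have := hh0 n
  have := hh0 0
  field_simp

/-- A vector with prescribed image under the `n`-th powers of both operators, provided `x` is
compatible with the collisions; on the common points only the first operator is consulted. -/
def commonPreimage (p : ℝ≥0∞) (β : ℝ) (h h' : ℕ → 𝕜) (M n : ℕ) (x : ℕ → 𝕜) : EllP 𝕜 p :=
  backwardSum p (forkMap 0) (forkPotential β 0 h) (Finset.range M) n x +
    backwardSum p (forkMap 1) (forkPotential β 1 h')
      {m ∈ Finset.range M | m ≠ rootedPow 1 (Nat.log 4 m)} n x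

theorem forkShift_zero_pow_commonPreimage {M n : ℕ} (hn : n ≠ 0) {x : EllP 𝕜 p}
    (hx : ∀ m, M ≤ m → x m = 0) :
    ((forkShift hβ zero_lt_two hh0 hh).toCLM p ^ n) (commonPreimage p β h h' M n x) = x := by
  ext l
  have hmem : l ∈ Finset.range M ∨ x l = 0 := by
    by_cases hl : l < M
    · exact Or.inl (Finset.mem_range.2 hl)
    · exact Or.inr (hx l (not_lt.1 hl))
  have hmod : (forkMap 0)^[n] l % 4 < 2 := by
    by_cases hl : l = rootedPow 0 (Nat.log 4 l)
    · rw [hl, iterate_forkMap_rootedPow_mod zero_lt_two _ hn]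
      norm_num
    · rw [iterate_forkMap_mod zero_lt_two hl hn]
      norm_num
  have hzero : backwardSum p (forkMap 1) (forkPotential β 1 h')
      {m ∈ Finset.range M | m ≠ rootedPow 1 (Nat.log 4 m)} n x ((forkMap 0)^[n] l) = 0 := by
    refine backwardSum_apply_eq_zero fun m hm hml => ?_
    have := iterate_forkMap_mod one_lt_two (Finset.mem_filter.1 hm).2 hn
    omega
  rw [forkShift_pow_apply, commonPreimage, lp.coeFn_add, Pi.add_apply, hzero, add_zero,
    backwardSum_apply_iterate (strictMono_forkMap zero_lt_two).injective hmem]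
  have h1 := forkPotential_ne_zero (s := 0) hβ hh0 l
  have h2 := forkPotential_ne_zero (s := 0) hβ hh0 ((forkMap 0)^[n] l)
  field_simp

theorem forkShift_one_pow_commonPreimage (hh0 : ∀ j, h j ≠ 0)
    (hh : ∀ j, ‖h (j + 1)‖ ≤ β * ‖h j‖) {M n : ℕ} (hn : n ≠ 0) {x : EllP 𝕜 p}
    (hx : ∀ m, M ≤ m → x m = 0) (h00 : h' 0 = h 0) (hx1 : x 1 = h' n / h n * x 0)
    (hrec : ∀ j, j ≠ 0 → j < M → h' (n + j) / h (n + j) = h' j / h j) :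
    ((forkShift hβ one_lt_two hh0' hh').toCLM p ^ n) (commonPreimage p β h h' M n x) = x := by
  have hT0 := forkShift_zero_pow_commonPreimage (hβ := hβ) (hh0 := hh0) (hh := hh) (h' := h') hn hx
  ext l
  by_cases hl : l = rootedPow 1 (Nat.log 4 l)
  · generalize Nat.log 4 l = j at hl
    rcases Nat.eq_zero_or_pos j with rfl | hj
    · obtain rfl : l = 1 := hl
      rw [forkShift_pow_apply_one (hh0 := hh0) (hh := hh) h00 hn, hT0, hx1]
    · -- Beyond the roots, the two orbits coincide.
      have hroot : ∀ k, rootedPow 1 (k + j) = rootedPow 0 (k + j) := fun k => by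
        simp [rootedPow, hj.ne']
      have hroot0 := hroot 0
      rw [zero_add] at hroot0
      have e := congrArg (fun y : EllP 𝕜 p => y (rootedPow 0 j)) hT0
      simp only [forkShift_pow_apply_rootedPow] at e
      rw [hl, forkShift_pow_apply_rootedPow, hroot, hroot0]
      have h1 := hh0 j
      have h2 := hh0' j
      have h3 := hh0 (n + j)
      rcases lt_or_ge j M with hjM | hjM
      · have hr := hrec j hj.ne' hjM
        rw [← e, show h' (n + j) / h' j = h (n + j) / h j by
          field_simp at hr ⊢
          linear_combination hr]
      · have hx0 : x (rootedPow 0 j) = 0 := by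
          refine hx _ (hjM.trans ?_)
          rw [rootedPow, if_neg hj.ne']
          exact (Nat.lt_pow_self (by norm_num)).le
        rw [hx0] at e ⊢
        rcases mul_eq_zero.1 e with e | e
        · exact absurd e (div_ne_zero h3 h1)
        · rw [e, mul_zero]
  · have hmem : l ∈ ({m ∈ Finset.range M | m ≠ rootedPow 1 (Nat.log 4 m)} : Finset ℕ) ∨ x l = 0 := by
      by_cases hlM : l < M
      · exact Or.inl (Finset.mem_filter.2 ⟨Finset.mem_range.2 hlM, hl⟩)
      · exact Or.inr (hx l (not_lt.1 hlM))
    have hzero : backwardSum p (forkMap 0) (forkPotential β 0 h) (Finset.range M) n x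
        ((forkMap 1)^[n] l) = 0 := by
      refine backwardSum_apply_eq_zero fun m _ hml => ?_
      have h1 := iterate_forkMap_mod one_lt_two hl hn
      rw [← hml] at h1
      by_cases hm : m = rootedPow 0 (Nat.log 4 m)
      · rw [hm, iterate_forkMap_rootedPow_mod zero_lt_two _ hn] at h1
        omega
      · rw [iterate_forkMap_mod zero_lt_two hm hn] at h1
        omega
    rw [forkShift_pow_apply, commonPreimage, lp.coeFn_add, Pi.add_apply, hzero, zero_add,
      backwardSum_apply_iterate (strictMono_forkMap one_lt_two).injective hmem]
    have h1 := forkPotential_ne_zero (s := 1) hβ hh0' l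
    have h2 := forkPotential_ne_zero (s := 1) hβ hh0' ((forkMap 1)^[n] l)
    field_simp

theorem tendsto_commonPreimage (hβ : 1 < β) {b : ℝ} (hb : 1 < b) (hbβ : b ≤ β)
    (hlow : ∀ j, b ^ j ≤ ‖h j‖) (hlow' : ∀ j, b ^ j ≤ ‖h' j‖) (M : ℕ) (x : ℕ → 𝕜) :
    Tendsto (fun n => commonPreimage p β h h' M n x) atTop (𝓝 0) := by
  rw [← add_zero (0 : EllP 𝕜 p)]
  exact (tendsto_backwardSum (strictMono_forkMap zero_lt_two) forkMap_zero_pos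
    (tendsto_norm_forkPotential hβ hb hbβ hlow)).add
    (tendsto_backwardSum (strictMono_forkMap one_lt_two) forkMap_zero_pos
      (tendsto_norm_forkPotential hβ hb hbβ hlow'))

/-- The Blow-up/Collapse Criterion holds along the powers of `2`, at which the ratio of the two
weight products runs through `ρ` and reproduces its own initial segments. -/
theorem sBlowUpCollapseCriterion_of_forkShift (hp : p ≠ ∞) {N : ℕ}
    {T : Fin N → EllP 𝕜 p →L[𝕜] EllP 𝕜 p}
    (hT : ∀ i, T i = (forkShift hβ zero_lt_two hh0 hh).toCLM p ∨
      T i = (forkShift hβ one_lt_two hh0' hh').toCLM p)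
    {b : ℝ} (hb : 1 < b) (hbβ : b ≤ β)
    (hlow : ∀ j, b ^ j ≤ ‖h j‖) (hlow' : ∀ j, b ^ j ≤ ‖h' j‖)
    {ρ : ℕ → 𝕜} (hρ0 : ρ 0 = 1) (hρ : Dense {d | ∃ᶠ v in atTop, ρ v = d})
    (hratio : ∀ n, h' n / h n = ρ (padicValNat 2 n)) :
    SBlowUpCollapseCriterion T := by
  have h00 : h' 0 = h 0 := by
    have := hratio 0
    rwa [padicValNat_zero_right, hρ0, div_eq_one_iff_eq (hh0 0)] at this
  have htwo : StrictMono fun k : ℕ => 2 ^ k := pow_right_strictMono₀ one_lt_two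
  choose M hM using fun x : {x : EllP 𝕜 p | (∃ M, ∀ m, M ≤ m → x m = 0) ∧
    ∃ d ∈ {d | ∃ᶠ v in atTop, ρ v = d}, x 1 = d * x 0} => x.2.1
  refine ⟨fun k => 2 ^ k, _, fun k x => commonPreimage p β h h' (M x) (2 ^ k) (x : EllP 𝕜 p),
    htwo, fun k => by positivity, dense_finitelySupported_ratio hp hρ, ?_, ?_⟩
  · intro x hx i
    rcases hT i with hi | hi
    · rw [hi]
      exact tendsto_forkShift_pow x (hM ⟨x, hx⟩) htwo.tendsto_atTop
    · rw [hi]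
      exact tendsto_forkShift_pow x (hM ⟨x, hx⟩) htwo.tendsto_atTop
  · intro ε hε K x
    obtain ⟨d, hd, hx1⟩ := x.2.2
    have hsmall := ((tendsto_commonPreimage (p := p) hβ hb hbβ hlow hlow' (M x)
      (x : EllP 𝕜 p)).comp htwo.tendsto_atTop).norm
    rw [norm_zero] at hsmall
    obtain ⟨k, hk, hkK, hkM, hkε⟩ := (hd.and_eventually ((eventually_ge_atTop K).and
      ((htwo.tendsto_atTop.eventually_ge_atTop (M x)).and (hsmall.eventually_lt_const hε)))).exists
    refine ⟨k, hkK, hkε, fun i => ?_⟩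
    have hk0 : 2 ^ k ≠ 0 := by positivity
    have hfix : (T i ^ 2 ^ k) (commonPreimage p β h h' (M x) (2 ^ k) (x : EllP 𝕜 p)) = x := by
      rcases hT i with hi | hi
      · rw [hi]
        exact forkShift_zero_pow_commonPreimage hk0 (hM x)
      · rw [hi]
        refine forkShift_one_pow_commonPreimage hh0 hh hk0 (hM x) h00 ?_ ?_
        · rw [hratio, padicValNat.prime_pow, hk, hx1]
        · intro j hj hjM
          rw [hratio, hratio, padicValNat_two_pow_add hj (hjM.trans_le hkM)]
    rw [hfix, sub_self, norm_zero]
    exact hε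

end Pair

end

/-! ### Existence of the operators -/

theorem mainTheorem6 (𝕜 : Type*) [RCLike 𝕜] (p : ℝ≥0∞) [Fact (1 ≤ p)] (hp : p ≠ ∞)
    (N : ℕ) (hN : 2 ≤ N) (β : ℝ) (hβ : 1 < β) :
    ∃ P : Fin N → PseudoShift 𝕜,
      (∀ i, ‖(P i).toCLM p‖ = β) ∧
      SBlowUpCollapseCriterion (fun i => (P i).toCLM p) ∧
      SHypercyclic (fun i => (P i).toCLM p) ∧
      ¬ SHypercyclicityCriterion (fun i => (P i).toCLM p) := by
  obtain ⟨b, hb, hbβ⟩ : ∃ b : ℝ, 1 < b ∧ b ^ 4 = β :=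
    ⟨β ^ (1 / 4 : ℝ), Real.one_lt_rpow hβ (by norm_num), by
      rw [← Real.rpow_natCast, ← Real.rpow_mul (by positivity)]
      norm_num⟩
  obtain ⟨ρ, hρ0, hρ1, hρ2, hρ⟩ := exists_slow_recurrent_sequence 𝕜 hb
  let h : ℕ → 𝕜 := fun n => (dyadicGrowth b n : 𝕜)
  let h' : ℕ → 𝕜 := fun n => ρ (padicValNat 2 n) * (dyadicGrowth b n : 𝕜)
  have hnorm : ∀ j, ‖h j‖ = dyadicGrowth b j := fun j => by
    simp only [h, RCLike.norm_ofReal, abs_of_pos (dyadicGrowth_pos hb j)]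
  have hlow : ∀ j, b ^ j ≤ ‖h j‖ := fun j => by
    rw [hnorm]
    exact (pow_le_pow_right₀ hb.le (by omega)).trans (pow_le_dyadicGrowth hb j)
  have hlow' : ∀ j, b ^ j ≤ ‖h' j‖ := pow_le_norm_mul_dyadicGrowth hb hρ1
  have hh0 : ∀ j, h j ≠ 0 := fun j => norm_pos_iff.1 (lt_of_lt_of_le (by positivity) (hlow j))
  have hh0' : ∀ j, h' j ≠ 0 := fun j => norm_pos_iff.1 (lt_of_lt_of_le (by positivity) (hlow' j))
  have hh : ∀ j, ‖h (j + 1)‖ ≤ β * ‖h j‖ := fun j => by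
    rw [hnorm, hnorm, ← hbβ]
    exact dyadicGrowth_succ_le hb j
  have hh' : ∀ j, ‖h' (j + 1)‖ ≤ β * ‖h' j‖ := fun j => by
    rw [← hbβ]
    exact norm_mul_dyadicGrowth_succ_le hb hρ1 hρ2 j
  have hratio : ∀ n, h' n / h n = ρ (padicValNat 2 n) := fun n => mul_div_cancel_right₀ _ (hh0 n)
  have h00 : h' 0 = h 0 := by simp [h, h', hρ0]
  let P : Fin N → PseudoShift 𝕜 := fun i =>
    if (i : ℕ) = 0 then forkShift hβ zero_lt_two hh0 hh else forkShift hβ one_lt_two hh0' hh'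
  have hcrit : SBlowUpCollapseCriterion (fun i => (P i).toCLM p) := by
    refine sBlowUpCollapseCriterion_of_forkShift (hβ := hβ) (hh0 := hh0) (hh := hh) (hh0' := hh0')
      (hh' := hh') hp (fun i => ?_) hb (hbβ ▸ le_self_pow₀ hb.le (by norm_num)) hlow hlow' hρ0 hρ
      hratio
    by_cases hi : (i : ℕ) = 0 <;> simp [P, hi]
  have := separableSpace_ellP (𝕜 := 𝕜) hp
  refine ⟨P, fun i => ?_, hcrit, hcrit.sHypercyclic, ?_⟩
  · by_cases hi : (i : ℕ) = 0
    · simp only [P, if_pos hi]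
      exact norm_forkShift_toCLM hp
    · simp only [P, if_neg hi]
      exact norm_forkShift_toCLM hp
  · refine not_sHypercyclicityCriterion_of_ratio (i := ⟨0, by omega⟩) (j := ⟨1, by omega⟩)
      (r := fun n => h' n / h n) fun n hn x => ?_
    exact forkShift_pow_apply_one (hβ := hβ) (hh0 := hh0) (hh := hh) (hh0' := hh0') (hh' := hh') h00
      hn x
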